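/- For integers $0\le \ell<M$ and $0\le m\le M$ let $$Q_{sb}(\ell,m,M)=1-2^{-(M-\ell-1)}\sum_{j=0}^{M-m-1}\binom{M-\ell-1}{j}$$ be the single-block success probability for $X=[0,1]$. Let $\ell_{sb}^*(m,M)$ be the smallest integer $\ell\in\{0,\dots,M-1\}$ for which $Q_{sb}(\ell,m,M)$ is closest to $1/2$, and let $\ell_{mb}^*(m,M,B)$ be the smallest integer $\ell\in\{0,\dots,M-1\}$ for which $Q_{sb}(\ell,m,M)^B$ is closest to $1-1/e$. Define the finite-$N$ phase transitions $$\varepsilon^*_{sb}(m,M)=\frac{\ell^*_{sb}(m,M)}{M},\qquad \varepsilon^*_{mb}(m,M,B)=\frac{B\,\ell^*_{mb}(m,M,B)}{B\,M},$$ and let $\varepsilon^*_{asy}(\delta)=(2\delta-1)_+$ and $\gamma_M=\sqrt{2\log M/M}$. Consider a sequence of problem sizes $(m,M,B)$ with $B=M$, $M\to\infty$ and $m/M\to\delta\in(1/2,1)$. Then: 1. With $n=Bm$ and $N=BM$, $n\sim\delta N$. 2. $\varepsilon^*_{sb}(m,M)=\varepsilon^*_{asy}(m/M)+O(1/M)$.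 3. $\varepsilon^*_{mb}(m,M,B)=\varepsilon^*_{asy}(m/M)-\sqrt{2(1-\delta)}\,\gamma_M+o(\gamma_M)$. 4. If $m/M=\delta+O(1/M)$, then $\varepsilon^*_{sb}(m,M)=\varepsilon^*_{asy}(\delta)+O(1/M)$. 5. If $m/M=\delta+o(\gamma_M)$, then $\varepsilon^*_{mb}(m,M,B)=\varepsilon^*_{asy}(\delta)-\sqrt{2(1-\delta)}\,\gamma_M+o(\gamma_M)$. 6. $\varepsilon^*_{sb}(m,M)\to\varepsilon^*_{asy}(\delta)$ and $\varepsilon^*_{mb}(m,M,B)\to\varepsilon^*_{asy}(\delta)$. 7. $\varepsilon^*_{sb}(m,M)-\varepsilon^*_{mb}(m,M,B)\sim\sqrt{2(1-\delta)}\,\gamma_M$. -/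

import Mathlib

open Filter Topology Asymptotics

namespace MultiBlock

noncomputable section

/-- The binomial quantity `P_{k,n} = 2^{-(n-1)} ∑_{j=0}^{k-1} (n-1 choose j)` (for `n ≥ 1`). -/
def binomialTail (k n : ℕ) : ℝ :=
  (∑ j ∈ Finset.range k, ((n - 1).choose j : ℝ)) / 2 ^ (n - 1)

/-- The single-block success probability for coefficients in `[0,1]`,
`Q_sb(ℓ, m, M) = 1 - P_{M-m, M-ℓ}`, for `m ≤ M` and `ℓ < M`. -/
def Qsb (ℓ m M : ℕ) : ℝ :=
  1 - binomialTail (M - m) (M - ℓ)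

/-- The success probability of a problem made of `B` independent blocks. -/
def Qmb (ℓ m M B : ℕ) : ℝ :=
  Qsb ℓ m M ^ B

/-- The smallest integer `ℓ ∈ {0, …, M-1}` whose success probability `Q ℓ` is closest to `q`. -/
def criticalCount (Q : ℕ → ℝ) (q : ℝ) (M : ℕ) : ℕ :=
  sInf {ℓ : ℕ | ℓ < M ∧ ∀ j < M, |Q ℓ - q| ≤ |Q j - q|}

/-- The reference success level of the single-block problem. -/
def qStarSb : ℝ := 1 / 2

/-- The reference success level of the multi-block problem. -/
def qStarMb : ℝ := 1 - 1 / Real.exp 1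

/-- The single-block finite-size phase transition location. -/
def epsSb (m M : ℕ) : ℝ :=
  (criticalCount (fun ℓ => Qsb ℓ m M) qStarSb M : ℝ) / M

/-- The multi-block finite-size phase transition location `k* / N`, with `k* = B ℓ*`, `N = B M`. -/
def epsMb (m M B : ℕ) : ℝ :=
  ((B : ℝ) * (criticalCount (fun ℓ => Qmb ℓ m M B) qStarMb M : ℝ)) / ((B : ℝ) * (M : ℝ))

/-- The asymptotic phase transition `(2δ - 1)_+`. -/
def epsAsy (δ : ℝ) : ℝ :=
  max (2 * δ - 1) 0

/-- `γ_M = √(2 log M / M)`. -/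
def gam (M : ℕ) : ℝ :=
  Real.sqrt (2 * Real.log M / M)

end

end MultiBlock

/-! The failure probability at `ℓ` is the chance that `n = M - ℓ - 1` fair coin tosses show fewer
than `k = M - m` heads. It grows with `ℓ`, so each critical count sits where the success probability
crosses its reference level.

For one block, symmetry makes the tail exactly `1/2` at `n = 2k - 1`, so the critical count is
exactly `2m - M` (`criticalCount_Qsb`) and the single-block error is eventually zero.

For `M` blocks the crossing occurs where the tail has order `1/M`. With `t = n - 2k` the tail is
`exp (-t^2 / (2n))` up to lower-order factors, and `n ~ 2(1-δ)M`, so `t^2 ~ 2n log M`, that is, `t ~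
√(2(1-δ)) M γ_M`. A Chernoff bound (`binomialTail_le_exp`) and a count of the largest summands
(`exp_le_binomialTail`) give the two directions. Constant factors in the tail do not affect this
leading order. -/

namespace MultiBlock

/-! ### Monotonicity and symmetry of the binomial tail -/

/-- By Pascal's rule every entry of row `n` with index below `k` is used twice, and the entry at `k`
only once. -/
theorem sum_choose_succ_add (n k : ℕ) :
    (∑ j ∈ Finset.range (k + 1), ((n + 1).choose j : ℝ)) + n.choose k =
      2 * ∑ j ∈ Finset.range (k + 1), (n.choose j : ℝ) := by
  induction k with
  | zero => norm_num
  | succ k ih =>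
    rw [Finset.sum_range_succ, Finset.sum_range_succ _ (k + 1), Nat.choose_succ_succ]
    push_cast
    linarith

theorem binomialTail_succ (k n : ℕ) :
    binomialTail (k + 1) (n + 2) =
      binomialTail (k + 1) (n + 1) - (n.choose k : ℝ) / 2 ^ (n + 1) := by
  have h := sum_choose_succ_add n k
  simp only [binomialTail, Nat.add_sub_cancel, show n + 2 - 1 = n + 1 by omega]
  rw [eq_sub_iff_add_eq, ← add_div, h, pow_succ]
  field_simp

theorem binomialTail_antitone (k : ℕ) : Antitone fun n => binomialTail (k + 1) (n + 1) := by
  refine antitone_nat_of_succ_le fun n => ?_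
  rw [binomialTail_succ k n]
  have : (0 : ℝ) ≤ (n.choose k : ℝ) / 2 ^ (n + 1) := by positivity
  linarith

theorem binomialTail_lt {k n n' : ℕ} (hk : k ≤ n) (hn : n < n') :
    binomialTail (k + 1) (n' + 1) < binomialTail (k + 1) (n + 1) := by
  refine (binomialTail_antitone k (Nat.succ_le_of_lt hn)).trans_lt ?_
  have h : (0 : ℝ) < (n.choose k : ℝ) / 2 ^ (n + 1) := by
    have : 0 < n.choose k := Nat.choose_pos hk
    positivity
  have := binomialTail_succ k n
  simp only [Nat.succ_eq_add_one, add_assoc, Nat.reduceAdd]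
  linarith

theorem binomialTail_le_one (k n : ℕ) : binomialTail k n ≤ 1 := by
  unfold binomialTail
  rw [div_le_one (by positivity)]
  have h : (∑ j ∈ Finset.range (n - 1 + 1), ((n - 1).choose j : ℝ)) = 2 ^ (n - 1) := by
    exact_mod_cast Nat.sum_range_choose (n - 1)
  rw [← h]
  rcases le_total k (n - 1 + 1) with hk | hk
  · exact Finset.sum_le_sum_of_subset_of_nonneg (Finset.range_mono hk) fun _ _ _ => by positivity
  · refine (Finset.sum_subset (Finset.range_mono hk) fun j _ hj => ?_).ge
    rw [Nat.choose_eq_zero_of_lt (by simpa using hj), Nat.cast_zero]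

/-- There are `2k + 1` tosses, an odd number, and the outcomes `0, …, k` are the lower half. -/
theorem binomialTail_two_mul (k : ℕ) : binomialTail (k + 1) (2 * k + 2) = 1 / 2 := by
  have h : (∑ j ∈ Finset.range (k + 1), ((2 * k + 1).choose j : ℝ)) = 4 ^ k := by
    exact_mod_cast Nat.sum_range_choose_halfway k
  simp only [binomialTail, show 2 * k + 2 - 1 = 2 * k + 1 by omega, h]
  rw [pow_succ, pow_mul]
  norm_num
  field_simp

theorem Qsb_nonneg (ℓ m M : ℕ) : 0 ≤ Qsb ℓ m M := sub_nonneg.2 (binomialTail_le_one _ _)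

theorem Qsb_antitone {m M j a : ℕ} (hm : m < M) (hj : j ≤ a) (ha : a < M) :
    Qsb a m M ≤ Qsb j m M := by
  have h := binomialTail_antitone (M - m - 1) (show M - a - 1 ≤ M - j - 1 by omega)
  simp only [show M - m - 1 + 1 = M - m by omega, show M - a - 1 + 1 = M - a by omega,
    show M - j - 1 + 1 = M - j by omega] at h
  unfold Qsb
  linarith

theorem Qsb_lt {m M j a : ℕ} (hm : m < M) (hj : j < a) (ha : a ≤ m) :
    Qsb a m M < Qsb j m M := by
  have h := binomialTail_lt (k := M - m - 1) (n := M - a - 1) (n' := M - j - 1)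
    (by omega) (by omega)
  simp only [show M - m - 1 + 1 = M - m by omega, show M - a - 1 + 1 = M - a by omega,
    show M - j - 1 + 1 = M - j by omega] at h
  unfold Qsb
  linarith

/-! ### Locating the critical count -/

theorem criticalCount_mem {M : ℕ} (hM : 0 < M) (Q : ℕ → ℝ) (q : ℝ) :
    criticalCount Q q M < M ∧ ∀ j < M, |Q (criticalCount Q q M) - q| ≤ |Q j - q| := by
  have hne : {ℓ : ℕ | ℓ < M ∧ ∀ j < M, |Q ℓ - q| ≤ |Q j - q|}.Nonempty := by
    obtain ⟨x, hx, h⟩ := Finset.exists_min_image (Finset.range M) (fun ℓ => |Q ℓ - q|)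
      ⟨0, Finset.mem_range.2 hM⟩
    exact ⟨x, Finset.mem_range.1 hx, fun j hj => h j (Finset.mem_range.2 hj)⟩
  exact Nat.sInf_mem hne

/-- Every index before `a` overshoots `q` by strictly more than `a` does; strictness excludes ties.
-/
theorem le_criticalCount {M a : ℕ} {Q : ℕ → ℝ} {q : ℝ} (ha : a < M) (hq : q ≤ Q a)
    (hQ : ∀ j < a, Q a < Q j) : a ≤ criticalCount Q q M := by
  obtain ⟨-, h⟩ := criticalCount_mem (by omega) Q q (M := M)
  by_contra! hlt
  have h1 := hQ _ hlt
  have h2 := h a ha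
  rw [abs_of_nonneg (by linarith), abs_of_nonneg (by linarith)] at h2
  linarith

/-- Weak monotonicity suffices here: a minimiser beyond `b` would make `b` a minimiser too, and the
smallest one is chosen. -/
theorem criticalCount_le {M b : ℕ} {Q : ℕ → ℝ} {q : ℝ} (hb : b < M) (hq : Q b ≤ q)
    (hQ : ∀ j < M, b ≤ j → Q j ≤ Q b) : criticalCount Q q M ≤ b := by
  by_contra! hlt
  obtain ⟨h0, h⟩ := criticalCount_mem (by omega) Q q (M := M)
  have h1 := hQ _ h0 hlt.le
  have hmem : b ∈ {ℓ : ℕ | ℓ < M ∧ ∀ j < M, |Q ℓ - q| ≤ |Q j - q|} := by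
    refine ⟨hb, fun j hj => le_trans ?_ (h j hj)⟩
    rw [abs_of_nonpos (by linarith), abs_of_nonpos (by linarith)]
    linarith
  exact absurd (Nat.sInf_le hmem) (not_le.2 hlt)

theorem criticalCount_Qsb {m M : ℕ} (hm : m < M) (hm' : M ≤ 2 * m) :
    criticalCount (fun ℓ => Qsb ℓ m M) qStarSb M = 2 * m - M := by
  have hQ : Qsb (2 * m - M) m M = qStarSb := by
    have h := binomialTail_two_mul (M - m - 1)
    rw [show M - m - 1 + 1 = M - m by omega,
      show 2 * (M - m - 1) + 2 = M - (2 * m - M) by omega] at h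
    rw [Qsb, h, qStarSb]
    norm_num
  apply le_antisymm
  · exact criticalCount_le (by omega) hQ.le fun j hj hbj => Qsb_antitone hm hbj hj
  · exact le_criticalCount (by omega) hQ.ge fun j hj => Qsb_lt hm hj (by omega)

/-- Bernoulli's inequality: `(1 - P)^B ≥ 1 - BP ≥ 1 - 1/e`. -/
theorem le_criticalCount_Qmb {m M B a : ℕ} (hm : m < M) (hB : B ≠ 0) (ha : a ≤ m)
    (h : B * binomialTail (M - m) (M - a) ≤ Real.exp (-1)) :
    a ≤ criticalCount (fun ℓ => Qmb ℓ m M B) qStarMb M := by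
  refine le_criticalCount (by omega) ?_ fun j hj => ?_
  · have h1 := one_add_mul_le_pow (a := -binomialTail (M - m) (M - a))
      (by have := binomialTail_le_one (M - m) (M - a); linarith) B
    rw [qStarMb, one_div, ← Real.exp_neg]
    simp only [Qmb, Qsb, sub_eq_add_neg] at h1 ⊢
    linarith
  · exact pow_lt_pow_left₀ (Qsb_lt hm hj ha) (Qsb_nonneg _ _ _) hB

/-- Here `(1 - P)^B ≤ exp (-BP) ≤ 1/e`, which is below `1 - 1/e` because `e > 2`. -/
theorem criticalCount_Qmb_le {m M B b : ℕ} (hm : m < M) (hb : b < M)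
    (h : 1 ≤ B * binomialTail (M - m) (M - b)) :
    criticalCount (fun ℓ => Qmb ℓ m M B) qStarMb M ≤ b := by
  refine criticalCount_le hb ?_ fun j hj hbj =>
    pow_le_pow_left₀ (Qsb_nonneg _ _ _) (Qsb_antitone hm hbj hj) B
  have h1 : Qsb b m M ≤ Real.exp (-binomialTail (M - m) (M - b)) := Real.one_sub_le_exp_neg _
  have h2 : Qmb b m M B ≤ Real.exp (-1) := by
    refine (pow_le_pow_left₀ (Qsb_nonneg _ _ _) h1 B).trans ?_
    rw [← Real.exp_nat_mul, Real.exp_le_exp]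
    linarith
  have h3 : 2 < Real.exp 1 := by linarith [Real.exp_one_gt_d9]
  have h4 : Real.exp (-1) ≤ 1 / 2 := by
    rw [Real.exp_neg, one_div]
    exact inv_anti₀ (by norm_num) h3.le
  rw [qStarMb, one_div, ← Real.exp_neg]
  linarith

/-! ### Upper and lower bounds for the binomial tail -/

/-- Chernoff's method: weight the `j`-th summand by `exp (u(n - 2j))`, sum to `(2 cosh u)^n`, and
use `cosh u ≤ exp (u^2/2)`. The chosen `u` minimises the exponent `-u(n - 2k) + n u^2/2`. -/
theorem binomialTail_le_exp {k n : ℕ} (hn : 0 < n) (h : 2 * k ≤ n) :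
    binomialTail k (n + 1) ≤ Real.exp (-((n : ℝ) - 2 * k) ^ 2 / (2 * n)) := by
  have hn' : (0 : ℝ) < n := by exact_mod_cast hn
  set u : ℝ := ((n : ℝ) - 2 * k) / n with hu
  have hu0 : 0 ≤ u := by
    have : (2 * k : ℝ) ≤ n := by exact_mod_cast h
    exact div_nonneg (by linarith) hn'.le
  have hsum : ∑ j ∈ Finset.range (n + 1), (n.choose j : ℝ) * Real.exp (u * (n - 2 * j)) =
      (2 * Real.cosh u) ^ n := by
    rw [Real.cosh_eq, mul_div_cancel₀ _ (two_ne_zero), add_comm (Real.exp u), add_pow]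
    refine Finset.sum_congr rfl fun j hj => ?_
    have hj' : j ≤ n := by simpa [Nat.lt_succ_iff] using hj
    rw [← Real.exp_nat_mul, ← Real.exp_nat_mul, ← Real.exp_add, mul_comm, Nat.cast_sub hj']
    ring_nf
  have hle : ∑ j ∈ Finset.range k, (n.choose j : ℝ) ≤
      Real.exp (-(u * (n - 2 * k))) * (2 * Real.cosh u) ^ n := by
    rw [← hsum, Finset.mul_sum]
    refine le_trans (Finset.sum_le_sum fun j hj => ?_)
      (Finset.sum_le_sum_of_subset_of_nonneg (Finset.range_mono (show k ≤ n + 1 by omega))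
        fun _ _ _ => by positivity)
    have hj' : (j : ℝ) ≤ k := by exact_mod_cast (Finset.mem_range.1 hj).le
    rw [mul_left_comm, ← Real.exp_add]
    refine le_mul_of_one_le_right (by positivity) (Real.one_le_exp ?_)
    nlinarith
  have hcosh : Real.cosh u ^ n ≤ Real.exp (n * (u ^ 2 / 2)) := by
    rw [Real.exp_nat_mul]
    exact pow_le_pow_left₀ (Real.cosh_pos u).le (Real.cosh_le_exp_half_sq u) n
  rw [binomialTail, Nat.add_sub_cancel, div_le_iff₀ (by positivity)]
  calc _ ≤ _ := hle
    _ ≤ Real.exp (-(u * (n - 2 * k))) * (2 ^ n * Real.exp (n * (u ^ 2 / 2))) := by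
      rw [mul_pow]; gcongr
    _ = Real.exp (-(u * (n - 2 * k)) + n * (u ^ 2 / 2)) * 2 ^ n := by
      rw [Real.exp_add]; ring
    _ = _ := by
      congr 2
      rw [hu]; field_simp; ring

/-- The induction step reduces to `4h(h+1) ≤ (2h+1)^2`. -/
theorem sixteen_pow_le_centralBinom_sq {h : ℕ} (hh : 0 < h) :
    16 ^ h ≤ h.centralBinom ^ 2 * (4 * h) := by
  induction h, hh using Nat.le_induction with
  | base => norm_num [Nat.centralBinom]
  | succ h hh ih =>
    have hr := Nat.succ_mul_centralBinom_succ h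
    refine Nat.le_of_mul_le_mul_left ?_ (Nat.add_one_pos h)
    calc (h + 1) * 16 ^ (h + 1) = 16 * (h + 1) * 16 ^ h := by ring
      _ ≤ 16 * (h + 1) * (h.centralBinom ^ 2 * (4 * h)) := by gcongr
      _ ≤ 4 * (2 * (2 * h + 1) * h.centralBinom) ^ 2 := by
        have := Nat.zero_le (h.centralBinom ^ 2)
        nlinarith
      _ = 4 * ((h + 1) * (h + 1).centralBinom) ^ 2 := by rw [hr]
      _ = _ := by ring

theorem four_pow_le_sqrt_mul_centralBinom {h : ℕ} (hh : 0 < h) :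
    (4 : ℝ) ^ h ≤ 2 * Real.sqrt h * h.centralBinom := by
  have h1 : (16 : ℝ) ^ h ≤ h.centralBinom ^ 2 * (4 * h) := by
    exact_mod_cast sixteen_pow_le_centralBinom_sq hh
  refine le_of_sq_le_sq ?_ (by positivity)
  rw [mul_pow, mul_pow, Real.sq_sqrt (by positivity), ← pow_mul, mul_comm h 2, pow_mul]
  norm_num
  linarith

/-- One step away from the centre multiplies the coefficient by `(h-y)/(h+y+1)`, which is at least
`exp (-(2y+1)/(h-y))`. The odd numbers `2y+1` add up to a square, and the cap `Y` keeps one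
denominator for all steps. -/
theorem centralBinom_mul_exp_le_choose {h Y : ℕ} (hY : Y < h) {y : ℕ} (hy : y ≤ Y) :
    (h.centralBinom : ℝ) * Real.exp (-((y : ℝ) ^ 2 / ((h : ℝ) - Y))) ≤
      (2 * h).choose (h - y) := by
  have hY' : (Y : ℝ) < h := by exact_mod_cast hY
  induction y with
  | zero => simp [Nat.centralBinom]
  | succ y ih =>
    have ih := ih (by omega)
    have hyY : (y : ℝ) + 1 ≤ Y := by exact_mod_cast hy
    have hy0 : (0 : ℝ) ≤ y := y.cast_nonneg
    have hrec : ((2 * h).choose (h - y) : ℝ) * (h - y) =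
        (2 * h).choose (h - (y + 1)) * (h + y + 1) := by
      have := Nat.choose_succ_right_eq (2 * h) (h - (y + 1))
      rw [show h - (y + 1) + 1 = h - y by omega,
        show 2 * h - (h - (y + 1)) = h + y + 1 by omega] at this
      have h2 : ((h - y : ℕ) : ℝ) = h - y := Nat.cast_sub (by omega)
      rw [← h2]
      exact_mod_cast this
    have hexp : Real.exp (-((2 * y + 1 : ℝ) / ((h : ℝ) - Y))) ≤ (h - y) / (h + y + 1) := by
      have h1 : (2 * y + 1 : ℝ) / ((h : ℝ) - y) ≤ (2 * y + 1 : ℝ) / ((h : ℝ) - Y) :=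
        div_le_div_of_nonneg_left (by linarith) (by linarith) (by linarith)
      have h2 := Real.add_one_le_exp ((2 * y + 1 : ℝ) / ((h : ℝ) - y))
      have h3 : (2 * y + 1 : ℝ) / ((h : ℝ) - y) + 1 = (h + y + 1) / (h - y) := by
        have : (h : ℝ) - y ≠ 0 := by linarith
        field_simp
        ring
      rw [Real.exp_neg, inv_le_comm₀ (Real.exp_pos _) (div_pos (by linarith) (by linarith)),
        inv_div, ← h3]
      exact h2.trans (Real.exp_le_exp.2 h1)
    have hsplit : -(((y + 1 : ℕ) : ℝ) ^ 2 / ((h : ℝ) - Y)) =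
        -((y : ℝ) ^ 2 / ((h : ℝ) - Y)) + -((2 * y + 1 : ℝ) / ((h : ℝ) - Y)) := by
      push_cast; ring
    rw [hsplit, Real.exp_add, ← mul_assoc]
    refine (mul_le_mul ih hexp (Real.exp_pos _).le (Nat.cast_nonneg _)).trans_eq ?_
    rw [← mul_div_assoc, hrec, mul_div_cancel_right₀ _ (by positivity)]

/-- A lower bound for the lower tail of a symmetric binomial law on `2 * h` trials, obtained from
the `w ≥ √h` largest summands. -/
theorem exp_le_binomialTail {k x w : ℕ} (hw : w < k) (hwk : k + x ≤ w ^ 2) :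
    Real.exp (-(((x : ℝ) + w) ^ 2 / ((k : ℝ) - w))) / 2 ≤ binomialTail k (2 * (k + x) + 1) := by
  set h := k + x with hh
  set E := Real.exp (-(((x : ℝ) + w) ^ 2 / ((k : ℝ) - w))) with hE
  have hE0 : 0 < E := Real.exp_pos _
  have hterm : ∀ i ∈ Finset.range w,
      (h.centralBinom : ℝ) * E ≤ (2 * h).choose (k - 1 - i) := by
    intro i hi
    have hi : i < w := Finset.mem_range.1 hi
    -- The cap `x + w` turns the denominator `h - Y` into `k - w`.
    have hb := centralBinom_mul_exp_le_choose (h := h) (Y := x + w) (by omega)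
      (y := x + 1 + i) (by omega)
    rw [show h - (x + 1 + i) = k - 1 - i by omega] at hb
    refine le_trans ?_ hb
    have hden : (h : ℝ) - (x + w : ℕ) = k - w := by rw [hh]; push_cast; ring
    rw [hden, hE]
    have hkw : (w : ℝ) < k := by exact_mod_cast hw
    have hle : ((x + 1 + i : ℕ) : ℝ) ≤ (x : ℝ) + w := by
      have : x + 1 + i ≤ x + w := by omega
      exact_mod_cast this
    gcongr
  have hsum : w * ((h.centralBinom : ℝ) * E) ≤ ∑ j ∈ Finset.range k, ((2 * h).choose j : ℝ) := by
    rw [← Finset.sum_range_reflect]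
    calc w * ((h.centralBinom : ℝ) * E)
        = ∑ _i ∈ Finset.range w, ((h.centralBinom : ℝ) * E) := by simp
      _ ≤ ∑ i ∈ Finset.range w, ((2 * h).choose (k - 1 - i) : ℝ) := Finset.sum_le_sum hterm
      _ ≤ _ := Finset.sum_le_sum_of_subset_of_nonneg (Finset.range_mono hw.le)
          fun _ _ _ => by positivity
  have hsqrt : Real.sqrt h ≤ w := by
    rw [Real.sqrt_le_left (by positivity)]
    exact_mod_cast hwk
  have hc := four_pow_le_sqrt_mul_centralBinom (h := h) (by omega)
  rw [binomialTail, Nat.add_sub_cancel, le_div_iff₀ (by positivity), pow_mul]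
  refine le_trans ?_ hsum
  calc E / 2 * (2 ^ 2) ^ h = E / 2 * 4 ^ h := by norm_num
    _ ≤ E / 2 * (2 * Real.sqrt h * h.centralBinom) := by gcongr
    _ = Real.sqrt h * (h.centralBinom * E) := by ring
    _ ≤ _ := by gcongr

/-! ### The scale `γ_M` -/

theorem tendsto_gam : Tendsto gam atTop (𝓝 0) := by
  have h1 : Tendsto (fun x : ℝ => Real.log x / x) atTop (𝓝 0) :=
    Real.isLittleO_log_id_atTop.tendsto_div_nhds_zero
  have h2 := ((h1.comp tendsto_natCast_atTop_atTop).const_mul 2).sqrt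
  simp only [mul_zero, Real.sqrt_zero] at h2
  refine h2.congr fun n => ?_
  simp [gam, mul_div_assoc]

theorem cast_mul_gam (M : ℕ) : (M : ℝ) * gam M = Real.sqrt (M * (2 * Real.log M)) := by
  rcases Nat.eq_zero_or_pos M with rfl | h
  · simp
  have h' : (0 : ℝ) < M := by exact_mod_cast h
  rw [gam, ← Real.sqrt_sq h'.le, ← Real.sqrt_mul (by positivity), Real.sqrt_sq h'.le]
  congr 1
  field_simp

theorem sq_mul_gam (M : ℕ) : ((M : ℝ) * gam M) ^ 2 = M * (2 * Real.log M) := by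
  rw [cast_mul_gam, Real.sq_sqrt]
  have := Real.log_natCast_nonneg M
  positivity

theorem gam_nonneg (M : ℕ) : 0 ≤ gam M := Real.sqrt_nonneg _

theorem tendsto_log_natCast : Tendsto (fun M : ℕ => Real.log M) atTop atTop :=
  Real.tendsto_log_atTop.comp tendsto_natCast_atTop_atTop

theorem eventually_le_mul_log {a : ℝ} (ha : 0 < a) (C : ℝ) :
    ∀ᶠ M : ℕ in atTop, C ≤ a * Real.log M :=
  (tendsto_log_natCast.const_mul_atTop ha).eventually_ge_atTop C

theorem eventually_sqrt_le_mul_gam {η : ℝ} (hη : 0 < η) :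
    ∀ᶠ M : ℕ in atTop, Real.sqrt M ≤ η * (M * gam M) := by
  filter_upwards [eventually_le_mul_log (a := 2 * η ^ 2) (by positivity) 1] with M hM
  have hg := gam_nonneg M
  rw [Real.sqrt_le_left (by positivity), mul_pow, sq_mul_gam]
  have := mul_le_mul_of_nonneg_left hM (Nat.cast_nonneg (α := ℝ) M)
  linarith

/-- Rounding the count by a bounded amount is therefore negligible on the scale `γ_M`. -/
theorem eventually_inv_le_mul_gam {η : ℝ} (hη : 0 < η) :
    ∀ᶠ M : ℕ in atTop, 1 / (M : ℝ) ≤ η * gam M := by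
  filter_upwards [eventually_sqrt_le_mul_gam hη, eventually_ge_atTop 1] with M hM h1
  have h1' : (1 : ℝ) ≤ M := by exact_mod_cast h1
  have h2 : (1 : ℝ) ≤ Real.sqrt M := Real.one_le_sqrt.2 h1'
  rw [div_le_iff₀ (by linarith)]
  linarith

/-! ### Critical counts and transitions along a sequence -/

section Sequences

variable {ι : Type*} {l : Filter ι} {m M : ι → ℕ} {δ : ℝ}

theorem eventually_lt_of_tendsto_div (hδ : δ < 1) (hM : Tendsto M l atTop)
    (hm : Tendsto (fun i => (m i : ℝ) / (M i : ℝ)) l (𝓝 δ)) : ∀ᶠ i in l, m i < M i := by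
  filter_upwards [hm.eventually_lt_const hδ, hM.eventually_ge_atTop 1] with i h h1
  have : (0 : ℝ) < M i := by exact_mod_cast h1
  rw [div_lt_one this] at h
  exact_mod_cast h

theorem eventually_le_criticalCount {c : ℝ} (hδ : δ ∈ Set.Ioo (1 / 2 : ℝ) 1)
    (hc : Real.sqrt (2 * (1 - δ)) < c) (hM : Tendsto M l atTop)
    (hm : Tendsto (fun i => (m i : ℝ) / (M i : ℝ)) l (𝓝 δ)) :
    ∀ᶠ i in l, 2 * (m i : ℝ) - M i - c * (M i * gam (M i)) - 2 ≤
      criticalCount (fun ℓ => Qmb ℓ (m i) (M i) (M i)) qStarMb (M i) := by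
  obtain ⟨hδ1, hδ2⟩ := hδ
  have hc0 : 0 < c := (Real.sqrt_nonneg _).trans_lt hc
  have hc2 : 2 * (1 - δ) < c ^ 2 := (Real.sqrt_lt' hc0).1 hc
  obtain ⟨r, hr1, hr2⟩ := exists_between hc2
  have hr0 : 0 < r := by linarith
  have hinv : Tendsto (fun i => 1 / (M i : ℝ)) l (𝓝 0) :=
    tendsto_one_div_atTop_nhds_zero_nat.comp hM
  -- This bounds `n / M`. Below `r`, it controls the Chernoff exponent; below `1`, it keeps the
  -- natural subtraction defining the test index from truncating.
  have hU : Tendsto (fun i => 2 * (1 - (m i : ℝ) / M i) + c * gam (M i) + 2 * (1 / (M i : ℝ)))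
      l (𝓝 (2 * (1 - δ))) := by
    have := ((hm.const_sub 1).const_mul 2).add ((tendsto_gam.comp hM).const_mul c) |>.add
      (hinv.const_mul 2)
    simpa using this
  filter_upwards [eventually_lt_of_tendsto_div hδ2 hM hm, hM.eventually_ge_atTop 1,
    hU.eventually_lt_const hr1, hU.eventually_lt_const (show 2 * (1 - δ) < 1 by linarith),
    hM.eventually (eventually_le_mul_log (a := c ^ 2 / r - 1)
      (by rw [sub_pos, one_lt_div hr0]; exact hr2) 1)] with i hmM h1 hUr hU1 hlog
  generalize m i = m at *
  generalize M i = M at *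
  have hM0 : (0 : ℝ) < M := by exact_mod_cast h1
  have hg := gam_nonneg M
  have hTnn : 0 ≤ c * (M * gam M) := by positivity
  obtain ⟨k, rfl⟩ := Nat.exists_eq_add_of_lt hmM
  set t := ⌈c * (((m + k + 1 : ℕ) : ℝ) * gam (m + k + 1))⌉₊ with ht
  have ht1 := Nat.le_ceil (c * (((m + k + 1 : ℕ) : ℝ) * gam (m + k + 1)))
  have ht2 := Nat.ceil_lt_add_one hTnn
  rw [← ht] at ht1 ht2
  have hMc : ((m + k + 1 : ℕ) : ℝ) = m + k + 1 := by push_cast; ring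
  have hUM : ((m + k + 1 : ℕ) : ℝ) * (2 * (1 - (m : ℝ) / (m + k + 1 : ℕ)) +
      c * gam (m + k + 1) + 2 * (1 / ((m + k + 1 : ℕ) : ℝ))) =
      2 * (k + 1) + c * (((m + k + 1 : ℕ) : ℝ) * gam (m + k + 1)) + 2 := by
    field_simp
    push_cast
    ring
  have hn1 : 2 * ((k : ℝ) + 1) + t + 1 < (m + k + 1 : ℕ) := by
    have := mul_lt_mul_of_pos_left hU1 hM0
    rw [hUM] at this
    linarith
  have hn2 : 2 * ((k : ℝ) + 1) + t < r * (m + k + 1 : ℕ) := by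
    have := mul_lt_mul_of_pos_left hUr hM0
    rw [hUM] at this
    linarith
  have hn1' : 2 * (k + 1) + t + 1 < m + k + 1 := by exact_mod_cast hn1
  -- The test index `2m - M - 1 - t` leaves `n = 2(M - m) + t` tosses. The ceiling in `t` and the
  -- extra `1` account for the `2` in the statement.
  have hcount := le_criticalCount_Qmb (m := m) (M := m + k + 1) (B := m + k + 1)
    (a := m + k + 1 - 1 - 2 * (k + 1) - t) hmM (by omega) (by omega) (by
      rw [show m + k + 1 - m = k + 1 by omega,
        show m + k + 1 - (m + k + 1 - 1 - 2 * (k + 1) - t) = 2 * (k + 1) + t + 1 by omega]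
      have hb := binomialTail_le_exp (k := k + 1) (n := 2 * (k + 1) + t) (by omega) (by omega)
      refine (mul_le_mul_of_nonneg_left hb hM0.le).trans ?_
      nth_rewrite 1 [← Real.exp_log hM0]
      rw [← Real.exp_add, Real.exp_le_exp]
      have hnpos : (0 : ℝ) < 2 * (k + 1) + t := by positivity
      -- The `1` comes from the target `exp (-1)`; the slack `c^2/r > 1` absorbs it.
      have hexp : Real.log (m + k + 1 : ℕ) + 1 ≤
          (t : ℝ) ^ 2 / (2 * (2 * (k + 1) + t)) := by
        have hL := Real.log_natCast_nonneg (m + k + 1)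
        calc Real.log (m + k + 1 : ℕ) + 1 ≤ c ^ 2 / r * Real.log (m + k + 1 : ℕ) := by linarith
          _ = (c * (((m + k + 1 : ℕ) : ℝ) * gam (m + k + 1))) ^ 2 /
              (2 * (r * (m + k + 1 : ℕ))) := by
            rw [mul_pow, sq_mul_gam]
            field_simp
          _ ≤ _ := by gcongr
      have hcast : ((2 * (k + 1) + t : ℕ) : ℝ) = 2 * (k + 1) + t := by push_cast; ring
      rw [hcast, neg_div]
      push_cast at hexp ⊢
      rw [show 2 * ((k : ℝ) + 1) + t - 2 * (k + 1) = t by ring]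
      linarith)
  have hcount' : m + k + 1 ≤ criticalCount (fun ℓ => Qmb ℓ m (m + k + 1) (m + k + 1)) qStarMb
      (m + k + 1) + 1 + 2 * (k + 1) + t := by omega
  have hcast : ((m + k + 1 : ℕ) : ℝ) ≤ criticalCount (fun ℓ => Qmb ℓ m (m + k + 1) (m + k + 1))
      qStarMb (m + k + 1) + 1 + 2 * (k + 1) + t := by exact_mod_cast hcount'
  linarith

theorem eventually_criticalCount_le {c : ℝ} (hδ : δ ∈ Set.Ioo (1 / 2 : ℝ) 1)
    (hc0 : 0 < c) (hc : c < Real.sqrt (2 * (1 - δ))) (hM : Tendsto M l atTop)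
    (hm : Tendsto (fun i => (m i : ℝ) / (M i : ℝ)) l (𝓝 δ)) :
    ∀ᶠ i in l, (criticalCount (fun ℓ => Qmb ℓ (m i) (M i) (M i)) qStarMb (M i) : ℝ) ≤
      2 * (m i : ℝ) - M i - c * (M i * gam (M i)) + 1 := by
  obtain ⟨hδ1, hδ2⟩ := hδ
  -- The gap between `c` and `c'` makes room for the `w = O(√M)` summands, and `r` between `c'^2/2`
  -- and `1 - δ` leaves a multiple of `log M` to pay for the factor `1/2` in the tail bound.
  obtain ⟨c', hc'1, hc'2⟩ := exists_between hc
  have hc'0 : 0 < c' := hc0.trans hc'1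
  have hc2 : c' ^ 2 / 2 < 1 - δ := by
    have := (Real.lt_sqrt hc'0.le).1 hc'2
    linarith
  obtain ⟨r, hr1, hr2⟩ := exists_between hc2
  have hr0 : 0 < r := lt_trans (by positivity) hr1
  have hU : Tendsto (fun i => 2 * (1 - (m i : ℝ) / M i) + c' * gam (M i) + 1 / (M i : ℝ))
      l (𝓝 (2 * (1 - δ))) := by
    have := ((hm.const_sub 1).const_mul 2).add ((tendsto_gam.comp hM).const_mul c') |>.add
      (tendsto_one_div_atTop_nhds_zero_nat.comp hM)
    simpa using this
  have hV : Tendsto (fun i => (1 - (m i : ℝ) / M i) - c' / 2 * gam (M i)) l (𝓝 (1 - δ)) := by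
    have := (hm.const_sub 1).sub ((tendsto_gam.comp hM).const_mul (c' / 2))
    simpa using this
  filter_upwards [eventually_lt_of_tendsto_div hδ2 hM hm, hM.eventually_ge_atTop 1,
    hV.eventually_const_lt hr2, hU.eventually_lt_const (show 2 * (1 - δ) < 1 by linarith),
    hM.eventually (eventually_le_mul_log (a := 1 - c' ^ 2 / (2 * r))
      (by rw [sub_pos, div_lt_one (by positivity)]; linarith) (Real.log 2)),
    hM.eventually (eventually_sqrt_le_mul_gam (η := (c' - c) / 4) (by linarith))]
    with i hmM h1 hVr hU1 hlog hsq
  generalize m i = m at *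
  generalize M i = N at *
  have hM0 : (0 : ℝ) < N := by exact_mod_cast h1
  have hg := gam_nonneg N
  obtain ⟨k, hNk⟩ := Nat.exists_eq_add_of_le hmM.le
  have hNk' : (N : ℝ) = m + k := by exact_mod_cast hNk
  set T : ℝ := N * gam N with hT
  have hT0 : 0 ≤ T := by positivity
  -- The lower bound needs an even number `2(k + x)` of tosses, so the shift is halved before
  -- rounding.
  set x := ⌊c * T / 2⌋₊ with hx
  have hx1 : (x : ℝ) ≤ c * T / 2 := Nat.floor_le (by positivity)
  have hx2 : c * T / 2 < x + 1 := Nat.lt_floor_add_one _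
  have hUM : 2 * (k : ℝ) + c' * T + 1 < N := by
    have := mul_lt_mul_of_pos_left hU1 hM0
    have he : (N : ℝ) * (2 * (1 - (m : ℝ) / N) + c' * gam N + 1 / (N : ℝ)) =
        2 * (N - m) + c' * (N * gam N) + 1 := by
      field_simp
    rw [he, ← hT] at this
    linarith
  have hVM : r * N < k - c' / 2 * T := by
    have := mul_lt_mul_of_pos_left hVr hM0
    have he : (N : ℝ) * ((1 - (m : ℝ) / N) - c' / 2 * gam N) =
        (N - m) - c' / 2 * (N * gam N) := by
      field_simp
    rw [he, ← hT] at this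
    linarith
  have hcT : c * T ≤ c' * T := mul_le_mul_of_nonneg_right hc'1.le hT0
  have hn : 2 * k + 2 * x + 1 < N := by
    have : 2 * (k : ℝ) + 2 * x + 1 < N := by linarith
    exact_mod_cast this
  set w := Nat.sqrt (k + x) + 1 with hw
  have hwsq : k + x ≤ w ^ 2 := by
    rw [sq]
    exact (Nat.lt_succ_sqrt (k + x)).le
  have hwle : (w : ℝ) ≤ 2 * Real.sqrt N := by
    have hs : ((Nat.sqrt (k + x) : ℕ) : ℝ) ≤ Real.sqrt N := by
      refine Real.nat_sqrt_le_real_sqrt.trans (Real.sqrt_le_sqrt ?_)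
      have : k + x ≤ N := by omega
      exact_mod_cast this
    have h1' : (1 : ℝ) ≤ Real.sqrt N := Real.one_le_sqrt.2 (by exact_mod_cast h1)
    rw [hw]
    push_cast
    linarith
  have hxw : (x : ℝ) + w ≤ c' * T / 2 := by linarith
  have hx0 : (0 : ℝ) ≤ x := x.cast_nonneg
  have hkw : r * N < (k : ℝ) - w := by linarith
  have hrN : 0 < r * N := by positivity
  have hwk : w < k := by
    have : (w : ℝ) < k := by linarith
    exact_mod_cast this
  have htail := exp_le_binomialTail hwk hwsq
  have hexp : ((x : ℝ) + w) ^ 2 / ((k : ℝ) - w) ≤ Real.log N - Real.log 2 := by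
    calc ((x : ℝ) + w) ^ 2 / ((k : ℝ) - w) ≤ (c' * T / 2) ^ 2 / (r * N) := by gcongr
      _ = c' ^ 2 / (2 * r) * Real.log N := by
        rw [div_pow, mul_pow, hT, sq_mul_gam]
        field_simp
      _ ≤ _ := by linarith
  have hcount := criticalCount_Qmb_le (m := m) (M := N) (B := N)
    (b := N - 1 - 2 * k - 2 * x) hmM (by omega) (by
      rw [show N - m = k by omega,
        show N - (N - 1 - 2 * k - 2 * x) = 2 * (k + x) + 1 by omega]
      refine le_trans ?_ (mul_le_mul_of_nonneg_left htail hM0.le)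
      have hlow : Real.exp (-(Real.log N - Real.log 2)) ≤
          Real.exp (-(((x : ℝ) + w) ^ 2 / ((k : ℝ) - w))) :=
        Real.exp_le_exp.2 (neg_le_neg hexp)
      rw [neg_sub, Real.exp_sub, Real.exp_log hM0, Real.exp_log two_pos, div_le_iff₀ hM0] at hlow
      linarith)
  have hcount' : criticalCount (fun ℓ => Qmb ℓ m N N) qStarMb N + 1 + 2 * k + 2 * x ≤ N := by
    omega
  have hcast : (criticalCount (fun ℓ => Qmb ℓ m N N) qStarMb N : ℝ) + 1 + 2 * k + 2 * x ≤ N := by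
    exact_mod_cast hcount'
  linarith

theorem epsMb_self {M : ℕ} (hM : 0 < M) (m : ℕ) : epsMb m M M =
    (criticalCount (fun ℓ => Qmb ℓ m M M) qStarMb M : ℝ) / M := by
  rw [epsMb, mul_div_mul_left]
  exact_mod_cast hM.ne'

theorem eventually_epsAsy_div (hδ : 1 / 2 < δ)
    (hm : Tendsto (fun i => (m i : ℝ) / (M i : ℝ)) l (𝓝 δ)) :
    ∀ᶠ i in l, epsAsy ((m i : ℝ) / M i) = 2 * ((m i : ℝ) / M i) - 1 := by
  filter_upwards [hm.eventually_const_lt hδ] with i hi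
  exact max_eq_left (by linarith)

theorem eventually_epsSb_eq (hδ : δ ∈ Set.Ioo (1 / 2 : ℝ) 1) (hM : Tendsto M l atTop)
    (hm : Tendsto (fun i => (m i : ℝ) / (M i : ℝ)) l (𝓝 δ)) :
    ∀ᶠ i in l, epsSb (m i) (M i) = epsAsy ((m i : ℝ) / M i) := by
  filter_upwards [eventually_epsAsy_div hδ.1 hm, hm.eventually_const_lt hδ.1,
    eventually_lt_of_tendsto_div hδ.2 hM hm, hM.eventually_ge_atTop 1] with i h1 h2 h3 h4
  have hM0 : (0 : ℝ) < M i := by exact_mod_cast h4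
  rw [lt_div_iff₀ hM0] at h2
  have h5 : M i ≤ 2 * m i := by
    have : (M i : ℝ) ≤ 2 * m i := by linarith
    exact_mod_cast this
  rw [h1, epsSb, criticalCount_Qsb h3 h5, Nat.cast_sub h5]
  push_cast
  field_simp

theorem epsMb_sub_isLittleO (hδ : δ ∈ Set.Ioo (1 / 2 : ℝ) 1) (hM : Tendsto M l atTop)
    (hm : Tendsto (fun i => (m i : ℝ) / (M i : ℝ)) l (𝓝 δ)) :
    (fun i => epsMb (m i) (M i) (M i) -
        (epsAsy ((m i : ℝ) / (M i : ℝ)) - Real.sqrt (2 * (1 - δ)) * gam (M i)))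
      =o[l] fun i => gam (M i) := by
  set s := Real.sqrt (2 * (1 - δ)) with hs
  have hs0 : 0 < s := Real.sqrt_pos.2 (by linarith [hδ.2])
  rw [isLittleO_iff]
  intro η hη
  filter_upwards [eventually_epsAsy_div hδ.1 hm, hM.eventually_ge_atTop 1,
    eventually_le_criticalCount hδ (c := s + η / 2) (by linarith) hM hm,
    -- The maximum with `s / 2` keeps the constant positive when `η` is large.
    eventually_criticalCount_le hδ (c := max (s - η / 2) (s / 2))
      (lt_max_of_lt_right (by linarith)) (max_lt (by linarith) (by linarith)) hM hm,
    hM.eventually (eventually_inv_le_mul_gam (η := η / 4) (by linarith))] with i h1 h2 h3 h4 h5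
  have hM0 : (0 : ℝ) < M i := by exact_mod_cast h2
  have hg := gam_nonneg (M i)
  rw [h1, epsMb_self h2, Real.norm_of_nonneg hg, Real.norm_eq_abs, abs_le]
  set C : ℝ := (criticalCount (fun ℓ => Qmb ℓ (m i) (M i) (M i)) qStarMb (M i) : ℝ)
  have h6 : 1 ≤ η / 4 * (M i * gam (M i)) := by
    rw [div_le_iff₀ hM0] at h5
    linarith
  have h7 : (s - η / 2) * (M i * gam (M i)) ≤ max (s - η / 2) (s / 2) * (M i * gam (M i)) :=
    mul_le_mul_of_nonneg_right (le_max_left _ _) (by positivity)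
  have h8 : C / M i - (2 * ((m i : ℝ) / M i) - 1 - s * gam (M i)) =
      (C - (2 * m i - M i) + s * (M i * gam (M i))) / M i := by
    field_simp
    ring
  rw [h8, le_div_iff₀ hM0, div_le_iff₀ hM0]
  constructor <;> linarith

end Sequences

end MultiBlock

theorem lemma2p5 (δ : ℝ) (hδ : δ ∈ Set.Ioo (1 / 2 : ℝ) 1) (m M B : ℕ → ℕ)
    (hB : ∀ i, B i = M i) (hM : Tendsto M atTop atTop)
    (hm : Tendsto (fun i => (m i : ℝ) / (M i : ℝ)) atTop (𝓝 δ)) :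
    -- `n ∼ δ N`
    ((fun i => (B i : ℝ) * (m i : ℝ)) ~[atTop] fun i => δ * ((B i : ℝ) * (M i : ℝ))) ∧
    -- expansions around the asymptotic transition at the actual ratio `m / M`
    ((fun i => MultiBlock.epsSb (m i) (M i) - MultiBlock.epsAsy ((m i : ℝ) / (M i : ℝ)))
      =O[atTop] fun i => 1 / (M i : ℝ)) ∧
    ((fun i => MultiBlock.epsMb (m i) (M i) (B i) -
        (MultiBlock.epsAsy ((m i : ℝ) / (M i : ℝ)) -
          Real.sqrt (2 * (1 - δ)) * MultiBlock.gam (M i)))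
      =o[atTop] fun i => MultiBlock.gam (M i)) ∧
    -- expansions around the asymptotic transition at the limiting ratio `δ`
    (((fun i => (m i : ℝ) / (M i : ℝ) - δ) =O[atTop] fun i => 1 / (M i : ℝ)) →
      (fun i => MultiBlock.epsSb (m i) (M i) - MultiBlock.epsAsy δ)
        =O[atTop] fun i => 1 / (M i : ℝ)) ∧
    (((fun i => (m i : ℝ) / (M i : ℝ) - δ) =o[atTop] fun i => MultiBlock.gam (M i)) →
      (fun i => MultiBlock.epsMb (m i) (M i) (B i) -
          (MultiBlock.epsAsy δ - Real.sqrt (2 * (1 - δ)) * MultiBlock.gam (M i)))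
        =o[atTop] fun i => MultiBlock.gam (M i)) ∧
    -- both transitions converge to the asymptotic one
    Tendsto (fun i => MultiBlock.epsSb (m i) (M i)) atTop (𝓝 (MultiBlock.epsAsy δ)) ∧
    Tendsto (fun i => MultiBlock.epsMb (m i) (M i) (B i)) atTop (𝓝 (MultiBlock.epsAsy δ)) ∧
    -- the offset of the multi-block transition below the single-block one
    ((fun i => MultiBlock.epsSb (m i) (M i) - MultiBlock.epsMb (m i) (M i) (B i))
      ~[atTop] fun i => Real.sqrt (2 * (1 - δ)) * MultiBlock.gam (M i)) := by
  obtain rfl : B = M := funext hB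
  have hMb := MultiBlock.epsMb_sub_isLittleO hδ hM hm
  have hSb := MultiBlock.eventually_epsSb_eq hδ hM hm
  have hasy := MultiBlock.eventually_epsAsy_div hδ.1 hm
  have hasyδ : MultiBlock.epsAsy δ = 2 * δ - 1 := max_eq_left (by linarith [hδ.1])
  have hgam : Tendsto (fun i => MultiBlock.gam (B i)) atTop (𝓝 0) :=
    MultiBlock.tendsto_gam.comp hM
  have hs0 : Real.sqrt (2 * (1 - δ)) ≠ 0 := (Real.sqrt_pos.2 (by linarith [hδ.2])).ne'
  have hasyT : Tendsto (fun i => MultiBlock.epsAsy ((m i : ℝ) / B i)) atTop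
      (𝓝 (MultiBlock.epsAsy δ)) := by
    rw [hasyδ]
    exact ((hm.const_mul 2).sub_const 1).congr' (hasy.mono fun i hi => hi.symm)
  refine ⟨?_, ?_, hMb, fun h => ?_, fun h => ?_, ?_, ?_, ?_⟩
  · refine isEquivalent_of_tendsto_one ?_
    have h := hm.div_const δ
    rw [div_self (by linarith [hδ.1])] at h
    refine h.congr' ?_
    filter_upwards [hM.eventually_ge_atTop 1] with i hi
    have hi0 : (0 : ℝ) < B i := by exact_mod_cast hi
    have hδ0 : δ ≠ 0 := by linarith [hδ.1]
    simp only [Pi.div_apply]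
    field_simp
  · refine (isBigO_zero _ _).congr' ?_ EventuallyEq.rfl
    filter_upwards [hSb] with i hi
    rw [hi, sub_self]
  · refine (h.const_mul_left 2).congr' ?_ EventuallyEq.rfl
    filter_upwards [hSb, hasy] with i h1 h2
    rw [h1, h2, hasyδ]
    ring
  · refine (hMb.add (h.const_mul_left 2)).congr' ?_ EventuallyEq.rfl
    filter_upwards [hasy] with i h2
    rw [h2, hasyδ]
    ring
  · exact hasyT.congr' (hSb.mono fun i hi => hi.symm)
  · have h := (hMb.trans_tendsto hgam).add (hasyT.sub (hgam.const_mul (Real.sqrt (2 * (1 - δ)))))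
    simpa using h
  -- Since the single-block error vanishes eventually, the gap minus its claimed value is the
  -- negated multi-block error.
  · refine IsLittleO.congr' (hMb.neg_left.const_mul_right hs0) ?_ EventuallyEq.rfl
    filter_upwards [hSb] with i hi
    simp only [Pi.sub_apply]
    rw [hi]
    ring
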